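/- Let $X=\{X_i\}_{i\ge1}$ be an exchangeable sequence of real random variables with distribution $\chi$ on $\mathbb{R}^\omega$, and let $\nu$ be its directing random measure, i.e. a random probability measure on $\mathbb{R}$ with $\Pr[X\in\cdot\mid\nu]=\nu^\infty$ a.s. For Borel $\gamma\subseteq\mathbb{R}$ put $V_\gamma:=\nu(\gamma)$. Let $\mathcal{A}_{\mathbb{Q}}$ be the class of finite unions of open intervals with rational endpoints, indexed in the canonical way; let $\overline{\tau}$ denote the closure of $\tau$. For $k\ge1$, call $\sigma=(\sigma(1),\dots,\sigma(k))\in\mathcal{A}_{\mathbb{Q}}^k$ an $X$-continuity set if $X_i\notin\partial\sigma(i)$ a.s. for $1\le i\le k$. The distribution $\chi$ is represented by the set of (indices of) pairs $(B,q)$ with $\chi(B)>q$, where $q\in\mathbb{Q}$ and $B$ is a finite union of cylinders $I_1\times\dots\times I_k\times\mathbb{R}^\omega$, with $k\ge1$ and the $I_j$ open intervals with rational endpoints. "Relative to $\chi$" means: by a program that is given, as an oracle, an arbitrary enumeration of this representation, the same program for all $\chi$ and all enumerations. A real $r$ is c.e. if $\{q\in\mathbb{Q}:q<r\}$ is c.e.,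 co-c.e. if $\{q\in\mathbb{Q}:q>r\}$ is c.e., and computable if it is both. Then, relative to $\chi$: 1. the mixed moments $\mathbb{E}\bigl(\prod_{i=1}^k V_{\sigma(i)}\bigr)$ are c.e. reals, uniformly in $k\ge1$ and $\sigma\in\mathcal{A}_{\mathbb{Q}}^k$; 2. the mixed moments $\mathbb{E}\bigl(\prod_{i=1}^k V_{\overline{\sigma(i)}}\bigr)$ are co-c.e. reals, uniformly in $k\ge1$ and $\sigma\in\mathcal{A}_{\mathbb{Q}}^k$; 3. in particular, if $\sigma\in\mathcal{A}_{\mathbb{Q}}^k$ is an $X$-continuity set, then $\mathbb{E}\bigl(\prod_{i=1}^k V_{\sigma(i)}\bigr)$ is a computable real, uniformly in $k\ge1$ and such $\sigma$. -/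

import Mathlib

open MeasureTheory ProbabilityTheory

/-! ### Programs with an oracle -/

/-- Programs for a machine that may query an oracle `g : ℕ → ℕ`: the codes for partial recursive
functions, with one additional instruction `oracle`. -/
inductive OracleCode : Type
  | zero : OracleCode
  | succ : OracleCode
  | left : OracleCode
  | right : OracleCode
  | oracle : OracleCode
  | pair : OracleCode → OracleCode → OracleCode
  | comp : OracleCode → OracleCode → OracleCode
  | prec : OracleCode → OracleCode → OracleCode
  | rfind : OracleCode → OracleCode

/-- The partial function computed by a program when it runs with oracle `g`. The clauses are those
of `Nat.RecursiveIn {g}`. -/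
def OracleCode.eval (g : ℕ → ℕ) : OracleCode → ℕ →. ℕ
  | zero => fun _ => Part.some 0
  | succ => fun n => Part.some (n + 1)
  | left => fun n => Part.some n.unpair.1
  | right => fun n => Part.some n.unpair.2
  | oracle => fun n => Part.some (g n)
  | pair cf ch => fun n => Nat.pair <$> eval g cf n <*> eval g ch n
  | comp cf ch => fun n => eval g ch n >>= eval g cf
  | prec cf ch => fun p =>
      p.unpair.2.rec (eval g cf p.unpair.1) fun y IH => do
        let i ← IH
        eval g ch (Nat.pair p.unpair.1 (Nat.pair y i))
  | rfind cf => fun a => Nat.rfind fun n => (fun m => m = 0) <$> eval g cf (Nat.pair a n)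

/-! ### Indices for rationals, rational intervals and the sets they generate -/

/-- Indices for rational numbers: `(a, b, d)` is an index for `(a - b) / (d + 1)`. -/
abbrev RatCode : Type := ℕ × ℕ × ℕ

/-- The rational number with a given index. Every rational number has an index. -/
def RatCode.val (q : RatCode) : ℚ := ((q.1 : ℚ) - (q.2.1 : ℚ)) / ((q.2.2 : ℚ) + 1)

/-- Indices for open intervals with rational endpoints. -/
abbrev IntervalCode : Type := RatCode × RatCode

/-- The open interval with a given index. -/
def IntervalCode.toSet (I : IntervalCode) : Set ℝ :=
  Set.Ioo ((RatCode.val I.1 : ℚ) : ℝ) ((RatCode.val I.2 : ℚ) : ℝ)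

/-- Indices for the rational interval algebra, i.e. for the finite unions of open intervals with
rational endpoints. -/
abbrev AlgCode : Type := List IntervalCode

/-- The finite union of open rational intervals with a given index. -/
def AlgCode.toSet (τ : AlgCode) : Set ℝ := ⋃ I ∈ τ, IntervalCode.toSet I

/-- The `k`-tuple of members of the rational interval algebra with a given index `σ`, where `k` is
the length of the list `σ`. -/
def tupleSet (σ : List AlgCode) (i : Fin σ.length) : Set ℝ := AlgCode.toSet (σ.get i)

/-- The cylinder `I₁ × ⋯ × I_k × ℝ × ℝ × ⋯` in `ℝ^ω`, for a list `I₁, …, I_k` of open rational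
intervals. -/
def cylinderSet (b : List IntervalCode) : Set (ℕ → ℝ) :=
  {x | ∀ i : Fin b.length, x i ∈ IntervalCode.toSet (b.get i)}

/-- The finite union of the cylinders in a list. -/
def cylinderUnion (B : List (List IntervalCode)) : Set (ℕ → ℝ) := ⋃ b ∈ B, cylinderSet b

/-! ### Representation of a distribution, and reals that are c.e. relative to it -/

/-- The representation of a distribution `χ` on `ℝ^ω`, as a set of indices: the pairs `(B, q)` with
`χ B > q`, where `q` is rational and `B` is a finite union of rational cylinders (each of which
restricts at least one coordinate). -/
def distRep (χ : Measure (ℕ → ℝ)) : Set ℕ :=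
  {n | ∃ (B : List (List IntervalCode)) (q : RatCode),
    (∀ b ∈ B, b ≠ []) ∧ ((RatCode.val q : ℚ) : ℝ) < χ.real (cylinderUnion B) ∧
      n = Encodable.encode (B, q)}

/-- `g` is an oracle for (the point with) representation `R`: it lists the members of `R`, in any
order and with any repetitions. A program with such an oracle uses positive information about `R`
only. Such a listing can be computed, uniformly, from the characteristic function of a nonempty
`R`. -/
def IsOracleFor (g : ℕ → ℕ) (R : Set ℕ) : Prop := Set.range g = R

/-- With oracle `g`, the reals `r i`, for the indices `i` in `S`, are uniformly c.e., as witnessed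
by the program `c`: given `i ∈ S` and (an index for) a rational `q`, it halts iff `q < r i`. -/
def UniformlyCE {ι : Type} [Primcodable ι] (c : OracleCode) (g : ℕ → ℕ) (S : Set ι)
    (r : ι → ℝ) : Prop :=
  ∀ i ∈ S, ∀ q : RatCode,
    (c.eval g (Encodable.encode (i, q))).Dom ↔ ((RatCode.val q : ℚ) : ℝ) < r i

/-- With oracle `g`, the reals `r i`, for the indices `i` in `S`, are uniformly co-c.e., as
witnessed by the program `c`: given `i ∈ S` and a rational `q`, it halts iff `r i < q`. -/
def UniformlyCoCE {ι : Type} [Primcodable ι] (c : OracleCode) (g : ℕ → ℕ) (S : Set ι)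
    (r : ι → ℝ) : Prop :=
  ∀ i ∈ S, ∀ q : RatCode,
    (c.eval g (Encodable.encode (i, q))).Dom ↔ r i < ((RatCode.val q : ℚ) : ℝ)

/-- With oracle `g`, the reals `r i`, for the indices `i` in `S`, are uniformly computable, i.e.
both uniformly c.e. and uniformly co-c.e., as witnessed by the programs `c` and `d`. -/
def UniformlyComputable {ι : Type} [Primcodable ι] (c d : OracleCode) (g : ℕ → ℕ) (S : Set ι)
    (r : ι → ℝ) : Prop :=
  UniformlyCE c g S r ∧ UniformlyCoCE d g S r

/-! ### Exchangeable sequences and mixed moments -/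

section Probability

variable {Ω : Type*} [MeasurableSpace Ω]

/-- A sequence of real random variables is exchangeable if, for all distinct indices
`k₁, …, k_j`, the vector `(X_{k₁}, …, X_{k_j})` has the distribution of the first `j` terms. -/
def Exchangeable (X : ℕ → Ω → ℝ) (P : Measure Ω) : Prop :=
  ∀ (j : ℕ) (k : Fin j → ℕ), Function.Injective k →
    P.map (fun ω (i : Fin j) => X (k i) ω) = P.map (fun ω (i : Fin j) => X i ω)

/-- The random probability measure `ν` directs the sequence `X`: conditionally on (the σ-algebra
generated by) `ν`, the sequence is i.i.d. with distribution `ν`, i.e.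
`P[X ∈ A | ν] = ν^∞ A` almost surely, for each measurable `A ⊆ ℝ^ω`. -/
def IsDirectingRandomMeasure (X : ℕ → Ω → ℝ) (P : Measure Ω) (ν : Kernel Ω ℝ)
    [IsMarkovKernel ν] : Prop :=
  ∀ A : Set (ℕ → ℝ), MeasurableSet A →
    P⟦(fun ω i => X i ω) ⁻¹' A | MeasurableSpace.comap (fun ω => ν ω) inferInstance⟧
      =ᵐ[P] fun ω => (Measure.infinitePi (fun _ : ℕ => ν ω)).real A

/-- The mixed moment `E (∏ᵢ V_{β(i)})`, where `V_γ = ν γ`. -/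
noncomputable def mixedMoment (P : Measure Ω) (ν : Kernel Ω ℝ) {k : ℕ} (β : Fin k → Set ℝ) : ℝ :=
  ∫ ω, ∏ i, (ν ω).real (β i) ∂P

/-- `β` is an `X`-continuity set: almost surely, no `X i` lies on the boundary of `β i`. -/
def IsContinuitySet (X : ℕ → Ω → ℝ) (P : Measure Ω) {k : ℕ} (β : Fin k → Set ℝ) : Prop :=
  ∀ i : Fin k, ∀ᵐ ω ∂P, X i ω ∉ frontier (β i)

end Probability

/-! ### Oracle programs for primitive recursive searches -/

/-! Integrating the directing identity `P[X ∈ A | ν] = ν^∞ A` over a box `A` turns every mixed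
moment into the `χ`-measure of that box (`mixedMoment_eq_map_real_box`). An open box, and likewise
the complement of a closed one, is a union of rational cylinders that pass a primitive recursive
test on endpoints. By continuity from below, such a union has measure above `q` iff some finite
subunion `B` does, and those pairs `(B, q)` are what the oracle lists (`exists_oracle_lt_iff`). A
single unbounded search through the oracle thus semidecides `q < r` for open boxes. For closed boxes
the same search on the complement semidecides `1 - q < 1 - r`. For a continuity set the two moments
agree, so both programs apply to it. -/

theorem OracleCode.eval_comp_of_eq_some {g : ℕ → ℕ} {ch : OracleCode} {n m : ℕ}
    (h : ch.eval g n = Part.some m) (cf : OracleCode) :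
    (OracleCode.comp cf ch).eval g n = cf.eval g m := by
  change (ch.eval g n).bind (cf.eval g) = _
  rw [h]
  exact Part.bind_some _ _

theorem OracleCode.exists_eval_eq_of_primrec {f : ℕ → ℕ} (hf : Nat.Primrec f) :
    ∃ c : OracleCode, ∀ g n, c.eval g n = Part.some (f n) := by
  induction hf with
  | zero => exact ⟨.zero, fun _ _ => rfl⟩
  | succ => exact ⟨.succ, fun _ _ => rfl⟩
  | left => exact ⟨.left, fun _ _ => rfl⟩
  | right => exact ⟨.right, fun _ _ => rfl⟩
  | pair _ _ ihf ihh =>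
    obtain ⟨cf, hcf⟩ := ihf
    obtain ⟨ch, hch⟩ := ihh
    refine ⟨.pair cf ch, fun g n => ?_⟩
    simp [OracleCode.eval, hcf, hch, Seq.seq]
  | comp _ _ ihf ihh =>
    obtain ⟨cf, hcf⟩ := ihf
    obtain ⟨ch, hch⟩ := ihh
    exact ⟨.comp cf ch, fun g n => (eval_comp_of_eq_some (hch g n) cf).trans (hcf g _)⟩
  | prec _ _ ihf ihh =>
    obtain ⟨cf, hcf⟩ := ihf
    obtain ⟨ch, hch⟩ := ihh
    refine ⟨.prec cf ch, fun g n => ?_⟩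
    simp only [OracleCode.eval, hcf, Nat.unpaired]
    induction n.unpair.2 with
    | zero => rfl
    | succ m ih =>
      simp only [ih]
      simp [hch]

/-- If `D` is a primitive recursive relation, then one program, with any oracle `g`, halts on `a`
iff `g` lists an index of some `b` with `D a b`. -/
theorem OracleCode.exists_search {α β : Type} [Primcodable α] [Primcodable β]
    {D : α → β → Prop} (hD : PrimrecRel D) :
    ∃ c : OracleCode, ∀ g a, (c.eval g (Encodable.encode a)).Dom ↔
      ∃ n b, Encodable.decode (g n) = some b ∧ D a b := by
  classical
  obtain ⟨f, hf, hf0⟩ : ∃ f : α × ℕ → ℕ, Primrec f ∧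
      ∀ a m, f (a, m) = 0 ↔ ∃ b, Encodable.decode m = some b ∧ D a b := by
    have hite : Primrec₂ fun (p : α × ℕ) (b : β) => if D p.1 b then 0 else 1 :=
      Primrec.ite (hD.comp (Primrec.fst.comp Primrec.fst) Primrec.snd)
        (Primrec.const 0) (Primrec.const 1)
    -- The value 0 signals success, as `rfind` expects; a number that decodes to nothing is rejected
    -- with 1.
    refine ⟨fun p => (Encodable.decode (α := β) p.2).elim 1 fun b => if D p.1 b then 0 else 1,
      (Primrec.option_casesOn (Primrec.decode.comp Primrec.snd) (Primrec.const 1) hite).of_eq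
        fun p => ?_, fun a m => ?_⟩
    · cases (Encodable.decode p.2 : Option β) <;> rfl
    · rcases h : (Encodable.decode m : Option β) with _ | b <;> simp [h]
  -- `Primrec f` concerns the encoding of an `Option` value, which is shifted by one; `pred` undoes
  -- the shift.
  obtain ⟨c, hc⟩ := exists_eval_eq_of_primrec (Nat.Primrec.pred.comp hf)
  have hc' : ∀ g a m, c.eval g (Nat.pair (Encodable.encode a) m) = Part.some (f (a, m)) := by
    intro g a m
    rw [hc]
    have : Nat.pair (Encodable.encode a) m = Encodable.encode (a, m) := rfl
    rw [this, Encodable.encodek]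
    rfl
  refine ⟨.rfind (.comp c (.pair .left (.comp .oracle .right))), fun g a => ?_⟩
  have hv : ∀ n, (OracleCode.comp c (.pair .left (.comp .oracle .right))).eval g
      (Nat.pair (Encodable.encode a) n) = Part.some (f (a, g n)) := by
    intro n
    have hp : (OracleCode.pair .left (.comp .oracle .right)).eval g
        (Nat.pair (Encodable.encode a) n) = Part.some (Nat.pair (Encodable.encode a) (g n)) := by
      simp [OracleCode.eval, Seq.seq]
    exact (eval_comp_of_eq_some hp c).trans (hc' g a (g n))
  let F : ℕ → Bool := fun n => decide (f (a, g n) = 0)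
  have hr : (OracleCode.rfind (.comp c (.pair .left (.comp .oracle .right)))).eval g
      (Encodable.encode a) = Nat.rfind (F : ℕ →. Bool) := by
    rw [OracleCode.eval]
    refine congrArg Nat.rfind (funext fun n => ?_)
    rw [hv]
    exact Part.map_some _ _
  rw [hr]
  refine Nat.rfind_dom.trans ?_
  simp only [← hf0]
  -- The tested function is total, so the search never gets stuck before a witness.
  exact ⟨fun ⟨n, hn, _⟩ => ⟨n, by simpa [F] using hn⟩,
    fun ⟨n, hn⟩ => ⟨n, by simpa [F] using hn, fun _ => trivial⟩⟩

/-! ### Primitive recursive relations between indices -/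

/-- Clearing denominators and moving subtracted terms across leaves a comparison of natural numbers,
which is visibly primitive recursive. -/
theorem ratCode_val_le_iff (p q : RatCode) :
    p.val ≤ q.val ↔
      p.1 * (q.2.2 + 1) + q.2.1 * (p.2.2 + 1) ≤ q.1 * (p.2.2 + 1) + p.2.1 * (q.2.2 + 1) := by
  rw [RatCode.val, RatCode.val, div_le_div_iff₀ (by positivity) (by positivity),
    ← Nat.cast_le (α := ℚ)]
  push_cast
  constructor <;> intro h <;> linarith

theorem one_sub_ratCode_val_le_iff (p q : RatCode) :
    1 - p.val ≤ q.val ↔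
      (p.2.2 + 1) * (q.2.2 + 1) + p.2.1 * (q.2.2 + 1) + q.2.1 * (p.2.2 + 1) ≤
        q.1 * (p.2.2 + 1) + p.1 * (q.2.2 + 1) := by
  have h : 1 - p.val = ((p.2.2 : ℚ) + 1 - p.1 + p.2.1) / (p.2.2 + 1) := by
    rw [RatCode.val]
    field_simp
    ring
  rw [h, RatCode.val, div_le_div_iff₀ (by positivity) (by positivity), ← Nat.cast_le (α := ℚ)]
  push_cast
  constructor <;> intro h <;> linarith

theorem exists_ratCode_val_eq (r : ℚ) : ∃ q : RatCode, q.val = r := by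
  refine ⟨(r.num.toNat, (-r.num).toNat, r.den - 1), ?_⟩
  have hd : ((r.den - 1 : ℕ) : ℚ) + 1 = r.den := by
    rw [Nat.cast_sub r.den_pos]
    simp
  have hn : ((r.num.toNat : ℕ) : ℚ) - ((-r.num).toNat : ℕ) = r.num := by
    have := Int.toNat_sub_toNat_neg r.num
    exact_mod_cast congrArg (Int.cast : ℤ → ℚ) this
  simp only [RatCode.val]
  rw [hd, hn, Rat.num_div_den]

theorem primrecRel_ratCode_val_le : PrimrecRel fun p q : RatCode => p.val ≤ q.val := by
  have num : Primrec fun x : RatCode => x.1 := Primrec.fst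
  have neg : Primrec fun x : RatCode => x.2.1 := Primrec.fst.comp Primrec.snd
  have den : Primrec fun x : RatCode => x.2.2 + 1 :=
    Primrec.succ.comp (Primrec.snd.comp Primrec.snd)
  have l := Primrec.fst (α := RatCode) (β := RatCode)
  have r := Primrec.snd (α := RatCode) (β := RatCode)
  refine PrimrecPred.of_eq (Primrec.nat_le.comp
    (Primrec.nat_add.comp (Primrec.nat_mul.comp (num.comp l) (den.comp r))
      (Primrec.nat_mul.comp (neg.comp r) (den.comp l)))
    (Primrec.nat_add.comp (Primrec.nat_mul.comp (num.comp r) (den.comp l))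
      (Primrec.nat_mul.comp (neg.comp l) (den.comp r))))
    fun x => (ratCode_val_le_iff x.1 x.2).symm

theorem primrecRel_one_sub_ratCode_val_le :
    PrimrecRel fun p q : RatCode => 1 - p.val ≤ q.val := by
  have num : Primrec fun x : RatCode => x.1 := Primrec.fst
  have neg : Primrec fun x : RatCode => x.2.1 := Primrec.fst.comp Primrec.snd
  have den : Primrec fun x : RatCode => x.2.2 + 1 :=
    Primrec.succ.comp (Primrec.snd.comp Primrec.snd)
  have l := Primrec.fst (α := RatCode) (β := RatCode)
  have r := Primrec.snd (α := RatCode) (β := RatCode)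
  refine PrimrecPred.of_eq (Primrec.nat_le.comp
    (Primrec.nat_add.comp
      (Primrec.nat_add.comp (Primrec.nat_mul.comp (den.comp l) (den.comp r))
        (Primrec.nat_mul.comp (neg.comp l) (den.comp r)))
      (Primrec.nat_mul.comp (neg.comp r) (den.comp l)))
    (Primrec.nat_add.comp (Primrec.nat_mul.comp (num.comp r) (den.comp l))
      (Primrec.nat_mul.comp (num.comp l) (den.comp r))))
    fun x => (one_sub_ratCode_val_le_iff x.1 x.2).symm

/-- A relation between indices that implies that the interval `J` contains the interval `I`. -/
def IntervalCode.Contains (J I : IntervalCode) : Prop := J.1.val ≤ I.1.val ∧ I.2.val ≤ J.2.val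

/-- The intervals with indices `J` and `I` are disjoint, as a relation between endpoints. -/
def IntervalCode.Apart (J I : IntervalCode) : Prop :=
  (J.2.val ≤ J.1.val ∨ J.2.val ≤ I.1.val) ∨ (I.2.val ≤ J.1.val ∨ I.2.val ≤ I.1.val)

theorem primrecRel_contains : PrimrecRel IntervalCode.Contains :=
  (primrecRel_ratCode_val_le.comp (Primrec.fst.comp Primrec.fst)
    (Primrec.fst.comp Primrec.snd)).and
  (primrecRel_ratCode_val_le.comp (Primrec.snd.comp Primrec.snd)
    (Primrec.snd.comp Primrec.fst))

theorem primrecRel_apart : PrimrecRel IntervalCode.Apart :=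
  have j := Primrec.fst (α := IntervalCode) (β := IntervalCode)
  have i := Primrec.snd (α := IntervalCode) (β := IntervalCode)
  have l := Primrec.fst (α := RatCode) (β := RatCode)
  have r := Primrec.snd (α := RatCode) (β := RatCode)
  ((primrecRel_ratCode_val_le.comp (r.comp j) (l.comp j)).or
    (primrecRel_ratCode_val_le.comp (r.comp j) (l.comp i))).or
  ((primrecRel_ratCode_val_le.comp (r.comp i) (l.comp j)).or
    (primrecRel_ratCode_val_le.comp (r.comp i) (l.comp i)))

/-- A relation between indices that implies that the cylinder of `b` lies in the box of `σ`. -/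
def CylinderInside (b : List IntervalCode) (σ : List AlgCode) : Prop :=
  ∀ i ∈ List.range σ.length, i < b.length ∧
    ∃ J ∈ σ.getD i [], IntervalCode.Contains J (b.getD i default)

/-- A relation between indices that implies that the cylinder of `b` is disjoint from the closed
box of `σ`. -/
def CylinderOutside (b : List IntervalCode) (σ : List AlgCode) : Prop :=
  ∃ i ∈ List.range σ.length, i < b.length ∧
    ∀ J ∈ σ.getD i [], IntervalCode.Apart J (b.getD i default)

theorem primrecRel_cylinderInside : PrimrecRel CylinderInside := by
  have hb : Primrec fun p : ℕ × (List IntervalCode × List AlgCode) => p.2.1 :=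
    Primrec.fst.comp Primrec.snd
  have hσ : Primrec fun p : ℕ × (List IntervalCode × List AlgCode) => p.2.2 :=
    Primrec.snd.comp Primrec.snd
  have h : PrimrecRel fun (i : ℕ) (p : List IntervalCode × List AlgCode) =>
      i < p.1.length ∧ ∃ J ∈ p.2.getD i [], IntervalCode.Contains J (p.1.getD i default) :=
    (Primrec.nat_lt.comp Primrec.fst (Primrec.list_length.comp hb)).and
      (primrecRel_contains.exists_mem_list.comp
        ((Primrec.list_getD []).comp hσ Primrec.fst)
        ((Primrec.list_getD default).comp hb Primrec.fst))
  exact h.forall_mem_list.comp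
    (Primrec.list_range.comp (Primrec.list_length.comp Primrec.snd)) Primrec.id

theorem primrecRel_cylinderOutside : PrimrecRel CylinderOutside := by
  have hb : Primrec fun p : ℕ × (List IntervalCode × List AlgCode) => p.2.1 :=
    Primrec.fst.comp Primrec.snd
  have hσ : Primrec fun p : ℕ × (List IntervalCode × List AlgCode) => p.2.2 :=
    Primrec.snd.comp Primrec.snd
  have h : PrimrecRel fun (i : ℕ) (p : List IntervalCode × List AlgCode) =>
      i < p.1.length ∧ ∀ J ∈ p.2.getD i [], IntervalCode.Apart J (p.1.getD i default) :=
    (Primrec.nat_lt.comp Primrec.fst (Primrec.list_length.comp hb)).and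
      (primrecRel_apart.forall_mem_list.comp
        ((Primrec.list_getD []).comp hσ Primrec.fst)
        ((Primrec.list_getD default).comp hb Primrec.fst))
  exact h.exists_mem_list.comp
    (Primrec.list_range.comp (Primrec.list_length.comp Primrec.snd)) Primrec.id

theorem primrecRel_forall_cylinder {T : List IntervalCode → List AlgCode → Prop}
    {R : RatCode → RatCode → Prop} (hT : PrimrecRel T) (hR : PrimrecRel R) :
    PrimrecRel fun (a : List AlgCode × RatCode) (B : List (List IntervalCode) × RatCode) =>
      (∀ b ∈ B.1, T b a.1) ∧ R a.2 B.2 :=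
  (hT.forall_mem_list.comp (Primrec.fst.comp Primrec.snd) (Primrec.fst.comp Primrec.fst)).and
    (hR.comp (Primrec.snd.comp Primrec.fst) (Primrec.snd.comp Primrec.snd))

/-! ### Boxes as unions of cylinders -/

theorem IntervalCode.isOpen_toSet (I : IntervalCode) : IsOpen I.toSet := isOpen_Ioo

theorem AlgCode.isOpen_toSet (τ : AlgCode) : IsOpen τ.toSet :=
  isOpen_biUnion fun I _ => I.isOpen_toSet

theorem IntervalCode.Contains.subset {J I : IntervalCode} (h : J.Contains I) :
    I.toSet ⊆ J.toSet :=
  Set.Ioo_subset_Ioo (by exact_mod_cast h.1) (by exact_mod_cast h.2)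

theorem IntervalCode.apart_iff_disjoint (J I : IntervalCode) :
    J.Apart I ↔ Disjoint J.toSet I.toSet := by
  rw [IntervalCode.toSet, IntervalCode.toSet, Set.Ioo_disjoint_Ioo, min_le_iff, le_max_iff,
    le_max_iff]
  simp only [Rat.cast_le]
  rfl

theorem exists_intervalCode_of_isOpen {U : Set ℝ} (hU : IsOpen U) {x : ℝ} (hx : x ∈ U) :
    ∃ I : IntervalCode, x ∈ I.toSet ∧ I.toSet ⊆ U := by
  obtain ⟨V, hV, hxV, hVU⟩ := Real.isTopologicalBasis_Ioo_rat.exists_subset_of_mem_open hx hU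
  simp only [Set.mem_iUnion, Set.mem_singleton_iff] at hV
  obtain ⟨a, b, -, rfl⟩ := hV
  obtain ⟨p, rfl⟩ := exists_ratCode_val_eq a
  obtain ⟨q, rfl⟩ := exists_ratCode_val_eq b
  exact ⟨(p, q), hxV, hVU⟩

/-- `CylinderInside` is stricter than inclusion, since each side must fit into a single listed
interval. The cylinders that pass still cover the box: around `x`, take as sides listed intervals
that contain the coordinates. -/
theorem box_eq_iUnion_cylinderSet (σ : List AlgCode) :
    {x : ℕ → ℝ | ∀ i : Fin σ.length, x i ∈ tupleSet σ i} =
      ⋃ b ∈ {b | CylinderInside b σ}, cylinderSet b := by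
  ext x
  simp only [Set.mem_ofPred_eq, Set.mem_iUnion, exists_prop]
  constructor
  · intro hx
    have hJ : ∀ i : Fin σ.length, ∃ J ∈ σ.get i, x i ∈ J.toSet := fun i => by
      simpa [tupleSet, AlgCode.toSet] using hx i
    choose J hJσ hxJ using hJ
    refine ⟨List.ofFn J, fun i hi => ?_, fun i => ?_⟩
    · have hi' : i < σ.length := List.mem_range.1 hi
      refine ⟨by simpa using hi', J ⟨i, hi'⟩, ?_, ?_⟩
      · rw [List.getD_eq_getElem _ _ hi']
        exact hJσ ⟨i, hi'⟩
      · rw [List.getD_eq_getElem _ _ (by simpa using hi')]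
        simp [IntervalCode.Contains]
    · have hi' : (i : ℕ) < σ.length := by simpa using i.2
      simpa using hxJ ⟨i, hi'⟩
  · rintro ⟨b, hb, hxb⟩ i
    obtain ⟨hib, J, hJ, hc⟩ := hb i (List.mem_range.2 i.2)
    rw [List.getD_eq_getElem _ _ i.2] at hJ
    rw [List.getD_eq_getElem _ _ hib] at hc
    exact Set.mem_biUnion (t := IntervalCode.toSet) (show J ∈ {J | J ∈ σ.get i} from hJ)
      (hc.subset (hxb ⟨i, hib⟩))

/-- A point outside fails at some coordinate `i`, where a rational interval around it misses the
closure. Conversely, an open side disjoint from a set is disjoint from its closure. -/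
theorem compl_closed_box_eq_iUnion_cylinderSet (σ : List AlgCode) :
    {x : ℕ → ℝ | ∀ i : Fin σ.length, x i ∈ closure (tupleSet σ i)}ᶜ =
      ⋃ b ∈ {b | CylinderOutside b σ}, cylinderSet b := by
  ext x
  simp only [Set.mem_compl_iff, Set.mem_ofPred_eq, Set.mem_iUnion, exists_prop, not_forall]
  constructor
  · rintro ⟨i, hi⟩
    -- A cylinder restricts an initial block of coordinates, so those before `i` get arbitrary
    -- intervals around `x j`.
    have hI : ∀ j : Fin (i + 1), ∃ I : IntervalCode, x j ∈ I.toSet ∧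
        ((j : ℕ) = i → I.toSet ⊆ (closure (tupleSet σ i))ᶜ) := by
      intro j
      by_cases hj : (j : ℕ) = i
      · obtain ⟨I, h₁, h₂⟩ := exists_intervalCode_of_isOpen isClosed_closure.isOpen_compl hi
        exact ⟨I, by rwa [hj], fun _ => h₂⟩
      · obtain ⟨I, h₁, -⟩ := exists_intervalCode_of_isOpen isOpen_univ (Set.mem_univ (x j))
        exact ⟨I, h₁, fun h => absurd h hj⟩
    choose I hxI hIσ using hI
    refine ⟨List.ofFn I, ⟨i, List.mem_range.2 i.2, by simp, fun J hJ => ?_⟩, fun j => ?_⟩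
    · rw [List.getD_eq_getElem _ _ i.2] at hJ
      rw [List.getD_eq_getElem _ _ (by simp), IntervalCode.apart_iff_disjoint, List.getElem_ofFn]
      refine Set.disjoint_left.2 fun y hyJ hyI => hIσ _ rfl hyI (subset_closure ?_)
      exact Set.mem_biUnion (t := IntervalCode.toSet) (show J ∈ {J | J ∈ σ.get i} from hJ) hyJ
    · rw [List.get_ofFn]
      exact hxI _
  · rintro ⟨b, ⟨i, hi, hib, hb⟩, hxb⟩
    have hi' : i < σ.length := List.mem_range.1 hi
    rw [List.getD_eq_getElem _ _ hi', List.getD_eq_getElem _ _ hib] at hb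
    refine ⟨⟨i, hi'⟩, fun hx => ?_⟩
    have hd : Disjoint (tupleSet σ ⟨i, hi'⟩) (b[i]).toSet := by
      refine Set.disjoint_iUnion₂_left.2 fun J hJ => ?_
      exact (IntervalCode.apart_iff_disjoint _ _).1 (hb J hJ)
    exact Set.disjoint_left.1 (hd.closure_left (b[i]).isOpen_toSet) hx (hxb ⟨i, hib⟩)

/-- The representation admits only cylinders with at least one side; this is where `k ≥ 1` enters.
-/
theorem CylinderInside.ne_nil {b : List IntervalCode} {σ : List AlgCode} (hσ : σ ≠ [])
    (h : CylinderInside b σ) : b ≠ [] :=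
  List.length_pos_iff.1 (h 0 (List.mem_range.2 (List.length_pos_iff.2 hσ))).1

theorem CylinderOutside.ne_nil {b : List IntervalCode} {σ : List AlgCode}
    (h : CylinderOutside b σ) : b ≠ [] := by
  obtain ⟨i, -, hi, -⟩ := h
  exact List.length_pos_iff.1 (by omega)

/-! ### Approximation of open sets from inside and mixed moments -/

theorem lt_measureReal_iUnion_cylinderSet_iff (χ : Measure (ℕ → ℝ)) [IsFiniteMeasure χ]
    (S : Set (List IntervalCode)) (r : ℝ) :
    r < χ.real (⋃ b ∈ S, cylinderSet b) ↔
      ∃ B : List (List IntervalCode), (∀ b ∈ B, b ∈ S) ∧ r < χ.real (cylinderUnion B) := by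
  have hsub : ∀ B : List (List IntervalCode), (∀ b ∈ B, b ∈ S) →
      cylinderUnion B ⊆ ⋃ b ∈ S, cylinderSet b := fun B hB =>
    Set.iUnion₂_subset fun b hb => Set.subset_biUnion_of_mem (u := cylinderSet) (hB b hb)
  constructor
  · intro h
    -- `ENNReal.ofReal` truncates negative numbers, so for negative `r` the empty union serves
    -- instead.
    rcases lt_or_ge r 0 with hr | hr
    · exact ⟨[], by simp, hr.trans_le measureReal_nonneg⟩
    let s : {B : List (List IntervalCode) // ∀ b ∈ B, b ∈ S} → Set (ℕ → ℝ) :=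
      fun B => cylinderUnion B.1
    have hdir : Directed (· ⊆ ·) s := by
      rintro ⟨B, hB⟩ ⟨C, hC⟩
      refine ⟨⟨B ++ C, fun b hb => (List.mem_append.1 hb).elim (hB b) (hC b)⟩, ?_, ?_⟩
      · exact Set.iUnion₂_subset fun b hb =>
          Set.subset_biUnion_of_mem (u := cylinderSet) (List.mem_append_left C hb)
      · exact Set.iUnion₂_subset fun b hb =>
          Set.subset_biUnion_of_mem (u := cylinderSet) (List.mem_append_right B hb)
    have hU : ⋃ b ∈ S, cylinderSet b = ⋃ B, s B := by
      refine Set.Subset.antisymm (Set.iUnion₂_subset fun b hb => ?_)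
        (Set.iUnion_subset fun B => hsub B.1 B.2)
      refine Set.subset_iUnion_of_subset ⟨[b], by simpa using hb⟩ ?_
      simp [s, cylinderUnion]
    rw [hU, measureReal_def, ← ENNReal.ofReal_lt_iff_lt_toReal hr (measure_ne_top _ _), hdir.measure_iUnion,
      lt_iSup_iff] at h
    obtain ⟨B, hB⟩ := h
    exact ⟨B.1, B.2, (ENNReal.ofReal_lt_iff_lt_toReal hr (measure_ne_top _ _)).1 hB⟩
  · rintro ⟨B, hB, h⟩
    exact h.trans_le (measureReal_mono (hsub B hB) (measure_ne_top _ _))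

/-- A listed bound is already strict, so the test `r ≤ q` is sound; it is complete because `r < χ B`
puts `(B, r)` itself on the list. -/
theorem exists_oracle_lt_iff {χ : Measure (ℕ → ℝ)} [IsFiniteMeasure χ] {g : ℕ → ℕ}
    (hg : IsOracleFor g (distRep χ)) {S : Set (List IntervalCode)} (hS : ∀ b ∈ S, b ≠ [])
    (r : ℚ) :
    (∃ n, ∃ B : List (List IntervalCode) × RatCode, Encodable.decode (g n) = some B ∧
      (∀ b ∈ B.1, b ∈ S) ∧ r ≤ B.2.val) ↔
      (r : ℝ) < χ.real (⋃ b ∈ S, cylinderSet b) := by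
  rw [lt_measureReal_iUnion_cylinderSet_iff]
  constructor
  · rintro ⟨n, ⟨B, q⟩, hn, hB, hr⟩
    have hmem : g n ∈ distRep χ := hg ▸ Set.mem_range_self n
    obtain ⟨B', q', -, hq', he⟩ := hmem
    rw [he, Encodable.encodek, Option.some_inj, Prod.mk.injEq] at hn
    obtain ⟨rfl, rfl⟩ := hn
    exact ⟨B', hB, lt_of_le_of_lt (by exact_mod_cast hr) hq'⟩
  · rintro ⟨B, hB, hr⟩
    obtain ⟨q, rfl⟩ := exists_ratCode_val_eq r
    have hmem : Encodable.encode (B, q) ∈ Set.range g :=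
      hg ▸ ⟨B, q, fun b hb => hS b (hB b hb), hr, rfl⟩
    obtain ⟨n, hn⟩ := hmem
    exact ⟨n, (B, q), by rw [hn, Encodable.encodek], hB, le_rfl⟩

section Moments

variable {Ω : Type*} [MeasurableSpace Ω]

theorem measurableSet_box {k : ℕ} {β : Fin k → Set ℝ} (hβ : ∀ i, MeasurableSet (β i)) :
    MeasurableSet {x : ℕ → ℝ | ∀ i : Fin k, x i ∈ β i} := by
  rw [Set.ofPred_forall]
  exact MeasurableSet.iInter fun i => measurable_pi_apply (i : ℕ) (hβ i)

theorem infinitePi_real_box (μ : Measure ℝ) [IsProbabilityMeasure μ] {k : ℕ} {β : Fin k → Set ℝ}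
    (hβ : ∀ i, MeasurableSet (β i)) :
    (Measure.infinitePi fun _ : ℕ => μ).real {x | ∀ i : Fin k, x i ∈ β i} =
      ∏ i, μ.real (β i) := by
  -- Padding by `Set.univ` presents the box as a product over a finite set of coordinates.
  let t : ℕ → Set ℝ := fun n => if h : n < k then β ⟨n, h⟩ else Set.univ
  have ht : ∀ i : Fin k, t i = β i := fun i => by simp [t]
  have hbox : {x : ℕ → ℝ | ∀ i : Fin k, x i ∈ β i} = Set.pi (Finset.range k) t := by
    ext x
    simp only [Set.mem_ofPred_eq, Set.mem_pi, Finset.coe_range, Set.mem_Iio]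
    exact ⟨fun h n hn => ht ⟨n, hn⟩ ▸ h ⟨n, hn⟩, fun h i => ht i ▸ h i i.2⟩
  have hm : ∀ n ∈ Finset.range k, MeasurableSet (t n) := fun n hn =>
    ht ⟨n, Finset.mem_range.1 hn⟩ ▸ hβ _
  rw [hbox, measureReal_def, Measure.infinitePi_pi _ hm, ENNReal.toReal_prod,
    Finset.prod_range]
  simp [ht, measureReal_def]

theorem mixedMoment_eq_map_real_box {P : Measure Ω} [IsProbabilityMeasure P] {X : ℕ → Ω → ℝ}
    {ν : Kernel Ω ℝ} [IsMarkovKernel ν] (hX : ∀ i, Measurable (X i))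
    (hν : IsDirectingRandomMeasure X P ν) {k : ℕ} {β : Fin k → Set ℝ}
    (hβ : ∀ i, MeasurableSet (β i)) :
    mixedMoment P ν β = (P.map fun ω i => X i ω).real {x | ∀ i : Fin k, x i ∈ β i} := by
  have hXm : Measurable fun ω i => X i ω := measurable_pi_lambda _ hX
  have hA := measurableSet_box hβ
  rw [map_measureReal_apply hXm hA,
    ← integral_condExp_indicator (μ := P) ν.measurable (hXm hA)]
  refine integral_congr_ae ?_
  filter_upwards [hν _ hA] with ω hω
  rw [hω, infinitePi_real_box _ hβ]

/-- For open `β i`, closure and set differ by the frontier, which `X i` almost surely avoids; the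
two box events therefore agree almost surely. -/
theorem mixedMoment_closure_eq {P : Measure Ω} [IsProbabilityMeasure P] {X : ℕ → Ω → ℝ}
    {ν : Kernel Ω ℝ} [IsMarkovKernel ν] (hX : ∀ i, Measurable (X i))
    (hν : IsDirectingRandomMeasure X P ν) {k : ℕ} {β : Fin k → Set ℝ}
    (hβ : ∀ i, IsOpen (β i)) (hc : IsContinuitySet X P β) :
    mixedMoment P ν (fun i => closure (β i)) = mixedMoment P ν β := by
  have hXm : Measurable fun ω i => X i ω := measurable_pi_lambda _ hX
  rw [mixedMoment_eq_map_real_box hX hν fun i => isClosed_closure.measurableSet,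
    mixedMoment_eq_map_real_box hX hν fun i => (hβ i).measurableSet,
    map_measureReal_apply hXm (measurableSet_box fun i => isClosed_closure.measurableSet),
    map_measureReal_apply hXm (measurableSet_box fun i => (hβ i).measurableSet)]
  refine measureReal_congr ?_
  filter_upwards [ae_all_iff.2 hc] with ω hω
  refine propext (forall_congr' fun i => ⟨fun h => ?_, fun h => subset_closure h⟩)
  by_contra hn
  exact hω i (by rw [(hβ i).frontier_eq]; exact ⟨h, hn⟩)

end Moments

theorem lemma5p2 :
    ∃ c d : OracleCode,
      ∀ (Ω : Type*) [MeasurableSpace Ω] (P : Measure Ω) [IsProbabilityMeasure P]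
        (X : ℕ → Ω → ℝ) (ν : Kernel Ω ℝ) [IsMarkovKernel ν] (χ : Measure (ℕ → ℝ)) (g : ℕ → ℕ),
        (∀ i, Measurable (X i)) → Exchangeable X P → IsDirectingRandomMeasure X P ν →
        χ = P.map (fun ω i => X i ω) → IsOracleFor g (distRep χ) →
        UniformlyCE c g {σ : List AlgCode | σ ≠ []}
            (fun σ => mixedMoment P ν (tupleSet σ)) ∧
          UniformlyCoCE d g {σ : List AlgCode | σ ≠ []}
            (fun σ => mixedMoment P ν (fun i => closure (tupleSet σ i))) ∧
          UniformlyComputable c d g {σ : List AlgCode | σ ≠ [] ∧ IsContinuitySet X P (tupleSet σ)}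
            (fun σ => mixedMoment P ν (tupleSet σ)) := by
  obtain ⟨c, hc⟩ := OracleCode.exists_search
    (primrecRel_forall_cylinder primrecRel_cylinderInside primrecRel_ratCode_val_le)
  obtain ⟨d, hd⟩ := OracleCode.exists_search
    (primrecRel_forall_cylinder primrecRel_cylinderOutside primrecRel_one_sub_ratCode_val_le)
  refine ⟨c, d, ?_⟩
  intro Ω _ P _ X ν _ χ g hX _ hν hχ hg
  have hopen : ∀ (σ : List AlgCode) i, IsOpen (tupleSet σ i) := fun σ i => (σ.get i).isOpen_toSet
  have : IsProbabilityMeasure χ :=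
    hχ ▸ Measure.isProbabilityMeasure_map (measurable_pi_lambda _ hX).aemeasurable
  have hCE : UniformlyCE c g {σ : List AlgCode | σ ≠ []}
      (fun σ => mixedMoment P ν (tupleSet σ)) := by
    intro σ hσ q
    refine (hc g (σ, q)).trans ?_
    beta_reduce
    rw [mixedMoment_eq_map_real_box hX hν fun i => (hopen σ i).measurableSet, ← hχ,
      box_eq_iUnion_cylinderSet,
      ← exists_oracle_lt_iff hg (S := {b | CylinderInside b σ}) fun b hb => hb.ne_nil hσ]
    rfl
  have hCoCE : UniformlyCoCE d g {σ : List AlgCode | σ ≠ []}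
      (fun σ => mixedMoment P ν (fun i => closure (tupleSet σ i))) := by
    intro σ _ q
    have hm : MeasurableSet {x : ℕ → ℝ | ∀ i : Fin σ.length, x i ∈ closure (tupleSet σ i)} :=
      measurableSet_box fun i => isClosed_closure.measurableSet
    -- An upper bound `q` on the closed box is the lower bound `1 - q` on its open complement, which
    -- the oracle can confirm.
    have hcompl := probReal_compl_eq_one_sub (μ := χ) hm
    rw [compl_closed_box_eq_iUnion_cylinderSet] at hcompl
    have hlt := exists_oracle_lt_iff hg (S := {b | CylinderOutside b σ})
      (fun b hb => hb.ne_nil) (1 - q.val)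
    refine ((hd g (σ, q)).trans hlt).trans ?_
    beta_reduce
    rw [mixedMoment_eq_map_real_box hX hν fun i => isClosed_closure.measurableSet, ← hχ, hcompl]
    push_cast
    exact sub_lt_sub_iff_left 1
  refine ⟨hCE, hCoCE, fun σ hσ => hCE σ hσ.1, fun σ hσ q => ?_⟩
  refine (hCoCE σ hσ.1 q).trans ?_
  simp only [mixedMoment_closure_eq hX hν (hopen σ) hσ.2]
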